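/- Let $k\ge 1$ and $n\ge 1$ be integers, let $G$ be a group isomorphic to $\mathbb Z_k=\mathbb Z/k\mathbb Z$ acting by group automorphisms on an abelian group $A\cong\mathbb Z^{n-1}$, and let $g_0$ be a generator of $G$. Let $T^{n-1}=\mathbb R^{n-1}/\mathbb Z^{n-1}$ be the standard torus, and let $g:T^{n-1}\to T^{n-1}$ be an affine diffeomorphism, i.e. a homeomorphism covered by an invertible affine map of $\mathbb R^{n-1}$. Let $g_*$ be the automorphism that $g$ induces on the (abelian) fundamental group $\pi_1(T^{n-1})$. Assume that $g_*=g_0$, meaning that for some isomorphism $\pi_1(T^{n-1})\cong A$ the automorphism $g_*$ corresponds to the action of $g_0$ on $A$. Let $M(g)$ be the mapping torus of $g$, obtained from $T^{n-1}\times[0,1]$ by gluing $(x,1)$ to $(g(x),0)$ for every $x\in T^{n-1}$. Then $$\operatorname{Tors} H_1(M(g),\mathbb Z)\;\cong\; H^1(G,A)\;\cong\;\operatorname{Tors}A_G,\qquad A_G=A/\operatorname{im}(g_0-\mathrm{id}),$$ where $H_1(M(g),\mathbb Z)$ is singular homology, $H^1(G,A)$ is group cohomology and $\operatorname{Tors}$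 denotes the torsion subgroup. -/

import Mathlib

/-- The equivalence relation on `X × ℝ` whose classes are the orbits of the action of `ℤ`
generated by `(x, t) ↦ (g x, t - 1)`. -/
def mappingTorusSetoid {X : Type*} [TopologicalSpace X] (g : X ≃ₜ X) : Setoid (X × ℝ) where
  r a b := ∃ j : ℤ, b.1 = (g ^ j) a.1 ∧ b.2 = a.2 - j
  iseqv :=
    { refl := fun a => ⟨0, by simp⟩
      symm := by
        rintro a b ⟨j, h1, h2⟩
        refine ⟨-j, ?_, ?_⟩
        · rw [h1, ← Homeomorph.mul_apply, ← zpow_add]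
          simp
        · rw [h2]
          push_cast
          ring
      trans := by
        rintro a b c ⟨i, h1, h2⟩ ⟨j, h3, h4⟩
        refine ⟨j + i, ?_, ?_⟩
        · rw [h3, h1, ← Homeomorph.mul_apply, ← zpow_add]
        · rw [h4, h2]
          push_cast
          ring }

/-- The mapping torus `M(g)` of a self-homeomorphism `g` of `X`: the quotient of `X × ℝ` by the
relation generated by `(x, t + 1) ∼ (g x, t)`, with the quotient topology. It is the space obtained
from `X × [0, 1]` by gluing `(x, 1)` to `(g x, 0)` for every `x`. -/
def MappingTorus {X : Type*} [TopologicalSpace X] (g : X ≃ₜ X) : Type _ :=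
  Quotient (mappingTorusSetoid g)

instance {X : Type*} [TopologicalSpace X] (g : X ≃ₜ X) : TopologicalSpace (MappingTorus g) :=
  inferInstanceAs (TopologicalSpace (Quotient (mappingTorusSetoid g)))

/-- The universal covering map `ℝ^m → T^m = (ℝ/ℤ)^m`. -/
def torusProj (m : ℕ) (x : Fin m → ℝ) : UnitAddTorus (Fin m) := fun i => (x i : UnitAddCircle)

/-- A self-homeomorphism of the flat torus `T^m = ℝ^m/ℤ^m` is an affine diffeomorphism if it is
covered by an affine automorphism of `ℝ^m`. -/
def IsAffineDiffeo {m : ℕ} (g : UnitAddTorus (Fin m) ≃ₜ UnitAddTorus (Fin m)) : Prop :=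
  ∃ φ : (Fin m → ℝ) ≃ᵃ[ℝ] (Fin m → ℝ), ∀ x, g (torusProj m x) = torusProj m (φ x)

/-- The endomorphism of `π₁(X, x₀)` induced by `g : X → X`, where `π₁(X, g x₀)` is identified with
`π₁(X, x₀)` along a path `p`. When `π₁(X, x₀)` is abelian, as it is for a torus, this does
not depend on `p`. -/
noncomputable def inducedPi1 {X : Type*} [TopologicalSpace X] (g : C(X, X)) {x₀ : X}
    (p : Path (g x₀) x₀) : FundamentalGroup X x₀ →* FundamentalGroup X x₀ :=
  (FundamentalGroup.fundamentalGroupMulEquivOfPath p).toMonoidHom.comp (FundamentalGroup.map g x₀)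

/-- The singular homology group `H₁(X, ℤ)`. -/
noncomputable abbrev singularH1 (X : Type) [TopologicalSpace X] : ModuleCat.{0} ℤ :=
  ((AlgebraicTopology.singularHomologyFunctor (ModuleCat.{0} ℤ) 1).obj (ModuleCat.of ℤ ℤ)).obj
    (TopCat.of X)

/-! Write `m = n - 1`, let `φ` be an affine lift of `g` and `L` the restriction of its linear part
to the lattice `ℤ^m`. The mapping torus is the quotient of the vector space `ℝ^m × ℝ` by the group
`Γ = ℤ^m ⋊ ℤ`, whose lattice translates the first factor and whose generator of `ℤ` acts by `(x, t)
↦ (φ x, t - 1)`.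

The homology of such a quotient is computed directly on chains: `H₁(E/Γ)` is the abelianization of
`Γ` whenever `Γ` acts on a real topological vector space `E` with quotient covering `E → E/Γ`
(`nonempty_singularH1_equiv_abelianization`). Here that abelianization is `ℤ^m / im(L - 1) × ℤ`, and
the factor `ℤ` has no torsion. Lifting loops of the torus to `ℝ^m` identifies `g_*` with `L`, so
that `Tors H₁(M(g)) ≅ Tors A_G`.

On the algebraic side, `H¹` of a finite cyclic group is `ker N / im(g₀ - 1)`, with `N` the norm. For
torsion-free `A`, the kernel of `N` is exactly the preimage of `Tors A_G` (`mem_ker_norm_iff`),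
hence `H¹(G, A) ≅ Tors A_G`. -/

section SingularHomology

open CategoryTheory AlgebraicTopology Simplicial

/-- The singular chain complex of `X` with integral coefficients. -/
noncomputable abbrev singularChains (X : Type) [TopologicalSpace X] :
    ChainComplex (ModuleCat.{0} ℤ) ℕ :=
  (TopCat.toSSet.obj (TopCat.of X)).chainComplex (ModuleCat.of ℤ ℤ)

/-! ### Singular 1-chains modulo boundaries, by generators and relations -/

namespace SingularChain

variable {X : Type} [TopologicalSpace X]

/-- The generator of the singular chains given by a singular simplex. -/
noncomputable def single {n : ℕ} (σ : C(stdSimplex ℝ (Fin (n + 1)), X)) :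
    (singularChains X).X n :=
  ((TopCat.toSSet.obj (TopCat.of X)).ιChainComplex (R := ModuleCat.of ℤ ℤ)
    (((TopCat.of X).toSSetObjEquiv (.op ⦋n⦌)).symm σ)).hom (1 : ℤ)

/-- The `i`-th face of a singular simplex. -/
noncomputable def face {n : ℕ} (i : Fin (n + 2)) (σ : C(stdSimplex ℝ (Fin (n + 2)), X)) :
    C(stdSimplex ℝ (Fin (n + 1)), X) :=
  σ.comp ⟨stdSimplex.map i.succAbove, stdSimplex.continuous_map _⟩

theorem d_single {n : ℕ} (σ : C(stdSimplex ℝ (Fin (n + 2)), X)) :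
    ((singularChains X).d (n + 1) n).hom (single σ) =
      ∑ i : Fin (n + 2), (-1 : ℤ) ^ i.val • single (face i σ) := by
  have h := congr_arg (fun φ => φ.hom (1 : ℤ))
    ((TopCat.toSSet.obj (TopCat.of X)).ιChainComplex_d (R := ModuleCat.of ℤ ℤ)
      (((TopCat.of X).toSSetObjEquiv (.op ⦋n + 1⦌)).symm σ))
  simp only [ModuleCat.hom_comp, LinearMap.comp_apply] at h
  refine h.trans ?_
  rw [ModuleCat.hom_sum, LinearMap.sum_apply]
  refine Finset.sum_congr rfl fun i _ => ?_
  have h2 : (TopCat.toSSet.obj (TopCat.of X)).δ i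
      (((TopCat.of X).toSSetObjEquiv (.op ⦋n + 1⦌)).symm σ) =
      ((TopCat.of X).toSSetObjEquiv (.op ⦋n⦌)).symm (face i σ) := rfl
  rw [h2]
  rfl

/-- The chain module is a coproduct of copies of `ℤ` indexed by simplices, so values on simplices
may be prescribed freely. -/
theorem exists_desc {n : ℕ} {D : Type} [AddCommGroup D]
    (F : C(stdSimplex ℝ (Fin (n + 1)), X) → D) :
    ∃ Ψ : (singularChains X).X n →+ D, ∀ σ, Ψ (single σ) = F σ := by
  let c : CategoryTheory.Limits.Cofan
      (fun _ : (TopCat.toSSet.obj (TopCat.of X)) _⦋n⦌ => ModuleCat.of ℤ ℤ) :=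
    .mk (ModuleCat.of ℤ D) fun s => ModuleCat.ofHom
      (LinearMap.toSpanSingleton ℤ D (F ((TopCat.of X).toSSetObjEquiv (.op ⦋n⦌) s)))
  refine ⟨(((TopCat.toSSet.obj (TopCat.of X)).isColimitChainComplexXCofan
    (ModuleCat.of ℤ ℤ) n).desc c).hom.toAddMonoidHom, fun σ => ?_⟩
  have h := congr_arg (fun φ => φ.hom (1 : ℤ))
    (((TopCat.toSSet.obj (TopCat.of X)).isColimitChainComplexXCofan (ModuleCat.of ℤ ℤ) n).fac c
      ⟨((TopCat.of X).toSSetObjEquiv (.op ⦋n⦌)).symm σ⟩)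
  refine h.trans ?_
  change (1 : ℤ) • F _ = _
  rw [one_smul, Equiv.apply_symm_apply]

/-- An additive map out of an object of `ModuleCat ℤ`, as a morphism. -/
def ofAddHom {M : ModuleCat.{0} ℤ} {D : Type} [AddCommGroup D] (Ψ : M →+ D) :
    M ⟶ ModuleCat.of ℤ D :=
  ModuleCat.ofHom
    { Ψ with map_smul' := fun n x => by simpa using map_intCast_smul Ψ ℤ ℤ n x }

theorem hom_ext {n : ℕ} {D : Type} [AddCommGroup D]
    {Ψ Ψ' : (singularChains X).X n →+ D} (h : ∀ σ, Ψ (single σ) = Ψ' (single σ)) :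
    Ψ = Ψ' := by
  have : ofAddHom Ψ = ofAddHom Ψ' := by
    refine SSet.chainComplex_hom_ext fun s => ?_
    ext
    have := h ((TopCat.of X).toSSetObjEquiv (.op ⦋n⦌) s)
    rw [single, Equiv.symm_apply_apply] at this
    exact this
  ext x
  exact congr_arg (fun φ => φ.hom x) this

/-- Singular chains of degree one modulo boundaries. -/
noncomputable abbrev Opcycles (X : Type) [TopologicalSpace X] : ModuleCat.{0} ℤ :=
  (singularChains X).opcycles 1

/-- The class of a singular `1`-simplex modulo boundaries. -/
noncomputable def cls (σ : C(stdSimplex ℝ (Fin 2), X)) : Opcycles X :=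
  ((singularChains X).pOpcycles 1).hom (single σ)

/-- The boundary map from `1`-chains modulo boundaries to `0`-chains. -/
noncomputable def bdry (X : Type) [TopologicalSpace X] : Opcycles X →+ (singularChains X).X 0 :=
  ((singularChains X).fromOpcycles 1 0).hom.toAddMonoidHom

/-- The `0`-chain of a point. -/
noncomputable def point (x : X) : (singularChains X).X 0 :=
  single (ContinuousMap.const _ x)

theorem bdry_cls (σ : C(stdSimplex ℝ (Fin 2), X)) :
    bdry X (cls σ) = point (σ (stdSimplex.vertex 1)) - point (σ (stdSimplex.vertex 0)) := by
  have h : bdry X (cls σ) = ((singularChains X).d 1 0).hom (single σ) :=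
    congr_arg (fun φ => φ.hom (single σ)) ((singularChains X).p_fromOpcycles 1 0)
  have hf : ∀ i : Fin 2,
      face i σ = ContinuousMap.const _ (σ (stdSimplex.vertex (i.succAbove 0))) := by
    intro i
    ext z
    obtain rfl : z = stdSimplex.vertex 0 := Subsingleton.elim _ _
    simp [face]
  rw [h, d_single]
  refine (Fin.sum_univ_two _).trans ?_
  simp only [hf]
  simp [point, sub_eq_add_neg]

theorem d_single_two (σ : C(stdSimplex ℝ (Fin 3), X)) :
    ((singularChains X).d 2 1).hom (single σ) =
      single (face 0 σ) - single (face 1 σ) + single (face 2 σ) := by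
  rw [d_single]
  refine (Fin.sum_univ_three _).trans ?_
  simp [sub_eq_add_neg]

theorem cls_face (σ : C(stdSimplex ℝ (Fin 3), X)) :
    cls (face 1 σ) = cls (face 2 σ) + cls (face 0 σ) := by
  have h := congr_arg (fun φ => φ.hom (single σ)) ((singularChains X).d_pOpcycles 2 1)
  simp only [ModuleCat.hom_comp, LinearMap.comp_apply] at h
  rw [d_single_two, map_add, map_sub] at h
  have h' : cls (face 0 σ) - cls (face 1 σ) + cls (face 2 σ) = 0 := h
  rw [← sub_eq_zero, ← neg_eq_zero, ← h']
  abel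

/-- By `cls_face`, `hF` is the only relation imposed by boundaries of 2-simplices. -/
theorem exists_desc_opcycles {D : Type} [AddCommGroup D] (F : C(stdSimplex ℝ (Fin 2), X) → D)
    (hF : ∀ σ : C(stdSimplex ℝ (Fin 3), X), F (face 1 σ) = F (face 2 σ) + F (face 0 σ)) :
    ∃ Ψ : Opcycles X →+ D, ∀ σ, Ψ (cls σ) = F σ := by
  obtain ⟨Ψ, hΨ⟩ := exists_desc F
  have h0 : (singularChains X).d 2 1 ≫ ofAddHom Ψ = 0 := by
    have : Ψ.comp ((singularChains X).d 2 1).hom.toAddMonoidHom = 0 := by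
      refine hom_ext fun σ => ?_
      have h := congr_arg Ψ (d_single_two σ)
      rw [map_add, map_sub, hΨ, hΨ, hΨ, hF] at h
      refine h.trans ?_
      simp
    ext x
    exact DFunLike.congr_fun this x
  refine ⟨((singularChains X).descOpcycles (ofAddHom Ψ) 2 (by simp) h0).hom.toAddMonoidHom,
    fun σ => ?_⟩
  have := congr_arg (fun φ => φ.hom (single σ))
    ((singularChains X).p_descOpcycles (ofAddHom Ψ) 2 (by simp) h0)
  exact this.trans (hΨ σ)

theorem opcycles_hom_ext {D : Type} [AddCommGroup D] {Ψ Ψ' : Opcycles X →+ D}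
    (h : ∀ σ, Ψ (cls σ) = Ψ' (cls σ)) : Ψ = Ψ' := by
  have : ofAddHom Ψ = ofAddHom Ψ' := by
    rw [← cancel_epi ((singularChains X).pOpcycles 1)]
    have := hom_ext (Ψ := Ψ.comp ((singularChains X).pOpcycles 1).hom.toAddMonoidHom)
      (Ψ' := Ψ'.comp ((singularChains X).pOpcycles 1).hom.toAddMonoidHom) h
    ext x
    exact DFunLike.congr_fun this x
  ext x
  exact congr_arg (fun φ => φ.hom x) this

/-- The first singular homology is the kernel of the boundary map on chains modulo boundaries. -/
theorem nonempty_equiv_ker_bdry (X : Type) [TopologicalSpace X] :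
    Nonempty (singularH1 X ≃+ (bdry X).ker) := by
  let K := singularChains X
  have hinj : Function.Injective (K.homologyι 1).hom :=
    (ModuleCat.mono_iff_injective _).1 inferInstance
  have hex : Function.Exact (K.homologyι 1).hom (K.fromOpcycles 1 0).hom :=
    (ShortComplex.ShortExact.moduleCat_exact_iff_function_exact _).1
      (ShortComplex.exact_of_f_is_kernel
        (ShortComplex.mk _ _ (K.homologyι_comp_fromOpcycles 1 0))
        (K.homologyIsKernel 1 0 (by simp)))
  refine ⟨AddEquiv.ofBijective
    ((K.homologyι 1).hom.toAddMonoidHom.codRestrict (bdry X).ker fun x => (hex _).2 ⟨x, rfl⟩)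
    ⟨fun x y h => hinj (congr_arg Subtype.val h), fun y => ?_⟩⟩
  obtain ⟨x, hx⟩ := (hex y.1).1 y.2
  exact ⟨x, Subtype.ext hx⟩

end SingularChain

/-! ### Topology and coordinates of the standard simplex -/

namespace stdSimplex

theorem continuous_coord {ι : Type*} [Fintype ι] (i : ι) :
    Continuous fun s : stdSimplex ℝ ι => s i :=
  (continuous_apply i).comp continuous_subtype_val

/-- With contractibility, this is what lets singular simplices lift through covering maps. -/
instance {ι : Type*} [Fintype ι] : LocallyPathConnectedSpace (stdSimplex ℝ ι) :=
  (convex_stdSimplex ℝ ι).locallyPathConnectedSpace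

instance {ι : Type*} [Fintype ι] [Nonempty ι] : ContractibleSpace (stdSimplex ℝ ι) :=
  (convex_stdSimplex ℝ ι).contractibleSpace (Set.nonempty_coe_sort.1 inferInstance)

theorem map_const {ι κ : Type*} [Fintype ι] [Fintype κ] [DecidableEq κ] (k : κ)
    (s : stdSimplex ℝ ι) : map (fun _ => k) s = vertex (S := ℝ) k := by
  have h : ∑ i, s i = 1 := stdSimplex.sum_eq_one s
  ext j
  rw [map_coe, FunOnFinite.linearMap_apply_apply, vertex_coe]
  by_cases hj : k = j
  · subst hj
    simp [h]
  · simp [hj, Ne.symm hj]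

theorem map_fin_two_apply {κ : Type*} [Fintype κ] [DecidableEq κ] (f : Fin 2 → κ)
    (s : stdSimplex ℝ (Fin 2)) (j : κ) :
    map f s j = (if f 0 = j then s 0 else 0) + (if f 1 = j then s 1 else 0) := by
  rw [map_coe, FunOnFinite.linearMap_apply_apply, Finset.sum_filter, Fin.sum_univ_two]

end stdSimplex

/-- The affine singular simplex with given endpoints. -/
def segmentSimplex {E : Type} [AddCommGroup E] [Module ℝ E] [TopologicalSpace E]
    [ContinuousAdd E] [ContinuousSMul ℝ E] (a b : E) : C(stdSimplex ℝ (Fin 2), E) where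
  toFun s := s 0 • a + s 1 • b
  continuous_toFun := ((stdSimplex.continuous_coord 0).smul continuous_const).add
    ((stdSimplex.continuous_coord 1).smul continuous_const)

namespace SingularChain

/-! ### Straightening 1-simplices in a vector space -/

section Affine

variable {E X : Type} [AddCommGroup E] [Module ℝ E] [TopologicalSpace E]
    [IsTopologicalAddGroup E] [ContinuousSMul ℝ E] [TopologicalSpace X]

@[simp] theorem segmentSimplex_vertex_zero (a b : E) :
    segmentSimplex a b (stdSimplex.vertex 0) = a := by
  simp [segmentSimplex]

@[simp] theorem segmentSimplex_vertex_one (a b : E) :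
    segmentSimplex a b (stdSimplex.vertex 1) = b := by
  simp [segmentSimplex]

theorem face_zero_apply (σ : C(stdSimplex ℝ (Fin 3), X)) (s : stdSimplex ℝ (Fin 2)) :
    face 0 σ s = σ (stdSimplex.map ![1, 2] s) := by
  have : Fin.succAbove (0 : Fin 3) = ![1, 2] := by decide
  rw [← this]
  rfl

theorem face_one_apply (σ : C(stdSimplex ℝ (Fin 3), X)) (s : stdSimplex ℝ (Fin 2)) :
    face 1 σ s = σ (stdSimplex.map ![0, 2] s) := by
  have : Fin.succAbove (1 : Fin 3) = ![0, 2] := by decide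
  rw [← this]
  rfl

theorem face_two_apply (σ : C(stdSimplex ℝ (Fin 3), X)) (s : stdSimplex ℝ (Fin 2)) :
    face 2 σ s = σ (stdSimplex.map ![0, 1] s) := by
  have : Fin.succAbove (2 : Fin 3) = ![0, 1] := by decide
  rw [← this]
  rfl

/-- All faces of a constant 2-simplex agree, so the face relation reads `c = c + c`. -/
theorem cls_const (x : X) : cls (ContinuousMap.const _ x) = 0 := by
  have h := cls_face (ContinuousMap.const (stdSimplex ℝ (Fin 3)) x)
  have hf : ∀ i, face i (ContinuousMap.const (stdSimplex ℝ (Fin 3)) x) =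
      ContinuousMap.const _ x := fun i => rfl
  simpa [hf] using h

/-- The affine triangle on `a`, `b`, `c` gives the relation. -/
theorem cls_segment_add (p : C(E, X)) (a b c : E) :
    cls (p.comp (segmentSimplex a c)) =
      cls (p.comp (segmentSimplex a b)) + cls (p.comp (segmentSimplex b c)) := by
  let σ : C(stdSimplex ℝ (Fin 3), E) :=
    ⟨fun s => s 0 • a + s 1 • b + s 2 • c,
      (((stdSimplex.continuous_coord 0).smul continuous_const).add
        ((stdSimplex.continuous_coord 1).smul continuous_const)).add
        ((stdSimplex.continuous_coord 2).smul continuous_const)⟩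
  have h := cls_face (p.comp σ)
  have h0 : face 0 (p.comp σ) = p.comp (segmentSimplex b c) := by
    ext s
    rw [face_zero_apply]
    simp [σ, segmentSimplex, stdSimplex.map_fin_two_apply, -stdSimplex.map_coe]
  have h1 : face 1 (p.comp σ) = p.comp (segmentSimplex a c) := by
    ext s
    rw [face_one_apply]
    simp [σ, segmentSimplex, stdSimplex.map_fin_two_apply, -stdSimplex.map_coe]
  have h2 : face 2 (p.comp σ) = p.comp (segmentSimplex a b) := by
    ext s
    rw [face_two_apply]
    simp [σ, segmentSimplex, stdSimplex.map_fin_two_apply, -stdSimplex.map_coe]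
  rwa [h0, h1, h2] at h

/-- The straight-line homotopy from the segment to `τ` fixes both endpoints. Its square is cut along
the diagonal into two triangles; the sides lying over the endpoints are constant and have class
zero, so both other sides have the class of the diagonal. -/
theorem cls_eq_cls_segment (p : C(E, X)) (τ : C(stdSimplex ℝ (Fin 2), E)) :
    cls (p.comp τ) =
      cls (p.comp (segmentSimplex (τ (stdSimplex.vertex 0)) (τ (stdSimplex.vertex 1)))) := by
  set ℓ := segmentSimplex (τ (stdSimplex.vertex 0)) (τ (stdSimplex.vertex 1)) with hℓ
  let H (r : C(stdSimplex ℝ (Fin 3), ℝ)) (f : Fin 3 → Fin 2) : C(stdSimplex ℝ (Fin 3), E) :=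
    ⟨fun s => (1 - r s) • ℓ (stdSimplex.map f s) + r s • τ (stdSimplex.map f s), by
      have := stdSimplex.continuous_map (S := ℝ) f
      fun_prop⟩
  let diag : C(stdSimplex ℝ (Fin 2), E) :=
    ⟨fun s => (1 - s 1) • ℓ s + s 1 • τ s, by
      have h := stdSimplex.continuous_coord (1 : Fin 2)
      exact ((continuous_const.sub h).smul ℓ.continuous).add (h.smul τ.continuous)⟩
  -- In coordinates (point of the edge, homotopy time), `T₁` has vertices (0,0), (1,0), (1,1) and
  -- `T₂` has vertices (0,0), (0,1), (1,1); they share the edge `diag`.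
  let T₁ := H ⟨fun s => s 2, stdSimplex.continuous_coord 2⟩ ![0, 1, 1]
  let T₂ := H ⟨fun s => 1 - s 0, continuous_const.sub (stdSimplex.continuous_coord 0)⟩ ![0, 0, 1]
  have comp0 : (![0, 1, 1] : Fin 3 → Fin 2) ∘ ![1, 2] = fun _ => 1 := by decide
  have comp1 : (![0, 1, 1] : Fin 3 → Fin 2) ∘ ![0, 2] = id := by decide
  have comp2 : (![0, 1, 1] : Fin 3 → Fin 2) ∘ ![0, 1] = id := by decide
  have comp0' : (![0, 0, 1] : Fin 3 → Fin 2) ∘ ![1, 2] = id := by decide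
  have comp1' : (![0, 0, 1] : Fin 3 → Fin 2) ∘ ![0, 2] = id := by decide
  have comp2' : (![0, 0, 1] : Fin 3 → Fin 2) ∘ ![0, 1] = fun _ => 0 := by decide
  have hT₁ : ∀ (f : Fin 2 → Fin 3) (s : stdSimplex ℝ (Fin 2)), p.comp T₁ (stdSimplex.map f s) =
      p ((1 - stdSimplex.map f s 2) • ℓ (stdSimplex.map (![0, 1, 1] ∘ f) s) +
        stdSimplex.map f s 2 • τ (stdSimplex.map (![0, 1, 1] ∘ f) s)) := fun f s => by
    rw [← stdSimplex.map_comp_apply]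
    rfl
  have hT₂ : ∀ (f : Fin 2 → Fin 3) (s : stdSimplex ℝ (Fin 2)), p.comp T₂ (stdSimplex.map f s) =
      p ((1 - (1 - stdSimplex.map f s 0)) • ℓ (stdSimplex.map (![0, 0, 1] ∘ f) s) +
        (1 - stdSimplex.map f s 0) • τ (stdSimplex.map (![0, 0, 1] ∘ f) s)) := fun f s => by
    rw [← stdSimplex.map_comp_apply]
    rfl
  have e10 : face 0 (p.comp T₁) = ContinuousMap.const _ (p (τ (stdSimplex.vertex 1))) := by
    ext s
    rw [face_zero_apply, hT₁, comp0, stdSimplex.map_const, hℓ, segmentSimplex_vertex_one,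
      ← add_smul, sub_add_cancel, one_smul]
    rfl
  have e11 : face 1 (p.comp T₁) = p.comp diag := by
    ext s
    rw [face_one_apply, hT₁, comp1, stdSimplex.map_id_apply]
    simp [diag, stdSimplex.map_fin_two_apply, -stdSimplex.map_coe]
  have e12 : face 2 (p.comp T₁) = p.comp ℓ := by
    ext s
    rw [face_two_apply, hT₁, comp2, stdSimplex.map_id_apply]
    simp [stdSimplex.map_fin_two_apply, -stdSimplex.map_coe]
  have e20 : face 0 (p.comp T₂) = p.comp τ := by
    ext s
    rw [face_zero_apply, hT₂, comp0', stdSimplex.map_id_apply]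
    simp [stdSimplex.map_fin_two_apply, -stdSimplex.map_coe]
  have e21 : face 1 (p.comp T₂) = p.comp diag := by
    ext s
    have hs : s 0 + s 1 = 1 := stdSimplex.add_eq_one s
    have hs' : s 0 = 1 - s 1 := by linarith
    rw [face_one_apply, hT₂, comp1', stdSimplex.map_id_apply]
    simp [diag, stdSimplex.map_fin_two_apply, -stdSimplex.map_coe, hs']
  have e22 : face 2 (p.comp T₂) = ContinuousMap.const _ (p (τ (stdSimplex.vertex 0))) := by
    ext s
    rw [face_two_apply, hT₂, comp2', stdSimplex.map_const, hℓ, segmentSimplex_vertex_zero,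
      ← add_smul, sub_add_cancel, one_smul]
    rfl
  have h1 := cls_face (p.comp T₁)
  have h2 := cls_face (p.comp T₂)
  rw [e10, e11, e12, cls_const, add_zero] at h1
  rw [e20, e21, e22, cls_const, zero_add] at h2
  rw [← h1, h2]

end Affine

/-! ### First homology of the quotient of a vector space by a deck group -/

theorem exists_lift {E X : Type} [TopologicalSpace E] [TopologicalSpace X] {p : E → X}
    (hp : IsCoveringMap p) {n : ℕ} (σ : C(stdSimplex ℝ (Fin (n + 1)), X)) {e : E}
    (he : p e = σ (stdSimplex.vertex 0)) :
    ∃ τ : C(stdSimplex ℝ (Fin (n + 1)), E), τ (stdSimplex.vertex 0) = e ∧ ∀ s, p (τ s) = σ s := by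
  obtain ⟨τ, ⟨h0, h1⟩, -⟩ :=
    hp.existsUnique_continuousMap_lifts σ (stdSimplex.vertex 0) e he
  exact ⟨τ, h0, congr_fun h1⟩

/-- If `Γ` acts on a real topological vector space `E` with quotient covering `E → X`, then the
first homology of `X` is the abelianization of `Γ`. -/
theorem nonempty_singularH1_equiv_abelianization {E X Γ : Type} [AddCommGroup E] [Module ℝ E]
    [TopologicalSpace E] [IsTopologicalAddGroup E] [ContinuousSMul ℝ E] [TopologicalSpace X]
    [Group Γ] [MulAction Γ E] {p : E → X} (hp : IsQuotientCoveringMap p Γ) :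
    Nonempty (singularH1 X ≃+ Additive (Abelianization Γ)) := by
  have cov := hp.isCoveringMap
  have hfree := hp.isCancelSMul
  have hcont := hp.toContinuousConstSMul
  let P : C(E, X) := ⟨p, hp.continuous⟩
  let D := Additive (Abelianization Γ)
  let q : Γ → D := fun γ => Additive.ofMul (Abelianization.of γ)
  have hq : ∀ γ γ', q (γ * γ') = q γ + q γ' := fun γ γ' => by simp [q]
  -- A set-theoretic section suffices: `c e` is the deck transformation taking the chosen point of
  -- the fibre to `e`, and no continuity is needed.
  let s : X → E := Function.surjInv hp.surjective
  have hs : ∀ x, p (s x) = x := Function.surjInv_eq hp.surjective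
  have hsγ : ∀ e, ∃ γ : Γ, γ • s (p e) = e := fun e =>
    hp.apply_eq_iff_mem_orbit.1 (hs (p e)).symm
  choose c hc using hsγ
  have hcγ : ∀ (γ : Γ) e, c (γ • e) = γ * c e := fun γ e => by
    have h : c (γ • e) • s (p e) = (γ * c e) • s (p e) := by
      have := hc (γ • e)
      rw [hp.map_smul] at this
      rw [this, mul_smul, hc]
    exact IsCancelSMul.right_cancel _ _ _ h
  let f : E → D := fun e => q (c e)
  have hf : ∀ (γ : Γ) e, f (γ • e) = q γ + f e := fun γ e => by simp only [f, hcγ, hq]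
  have hlift : ∀ {n : ℕ} (σ : C(stdSimplex ℝ (Fin (n + 1)), X)),
      ∃ τ : C(stdSimplex ℝ (Fin (n + 1)), E), ∀ t, p (τ t) = σ t := fun σ =>
    let ⟨τ, h⟩ := exists_lift cov σ (hs _)
    ⟨τ, h.2⟩
  -- Two lifts differ by a single `γ`, which adds the same `q γ` to `f` at both endpoints.
  have hdiff : ∀ τ τ' : C(stdSimplex ℝ (Fin 2), E), (∀ t, p (τ t) = p (τ' t)) →
      f (τ (stdSimplex.vertex 1)) - f (τ (stdSimplex.vertex 0)) =
        f (τ' (stdSimplex.vertex 1)) - f (τ' (stdSimplex.vertex 0)) := by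
    intro τ τ' h
    obtain ⟨γ, hγ⟩ := hp.apply_eq_iff_mem_orbit.1 (h (stdSimplex.vertex 0))
    have : (fun t => γ • τ' t) = τ := cov.eq_of_comp_eq (τ'.continuous.const_smul γ) τ.continuous
      (by ext t; simp [hp.map_smul, h]) (stdSimplex.vertex 0) hγ
    rw [← congr_fun this, ← congr_fun this, hf, hf]
    abel
  choose lift hlift' using fun σ : C(stdSimplex ℝ (Fin 2), X) => hlift σ
  let F : C(stdSimplex ℝ (Fin 2), X) → D := fun σ =>
    f (lift σ (stdSimplex.vertex 1)) - f (lift σ (stdSimplex.vertex 0))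
  have hF : ∀ τ : C(stdSimplex ℝ (Fin 2), E), F (P.comp τ) =
      f (τ (stdSimplex.vertex 1)) - f (τ (stdSimplex.vertex 0)) := fun τ =>
    hdiff _ _ (hlift' (P.comp τ))
  obtain ⟨Ψ, hΨ⟩ := exists_desc_opcycles F (by
    intro σ
    obtain ⟨τ, hτ⟩ := hlift σ
    obtain rfl : P.comp τ = σ := by ext t; exact hτ t
    have hface : ∀ i, face i (P.comp τ) = P.comp (face i τ) := fun i => rfl
    rw [hface, hface, hface, hF, hF, hF]
    simp [face, Fin.succAbove])
  let L : E → E → Opcycles X := fun a b => cls (P.comp (segmentSimplex a b))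
  have hL : ∀ a b c, L a c = L a b + L b c := fun a b c => cls_segment_add P a b c
  -- The action need not be affine: the translated segment is straightened, and its projection has
  -- not changed.
  have hLγ : ∀ (γ : Γ) a b, L (γ • a) (γ • b) = L a b := by
    intro γ a b
    let τ : C(stdSimplex ℝ (Fin 2), E) :=
      ⟨fun t => γ • segmentSimplex a b t, (segmentSimplex a b).continuous.const_smul γ⟩
    have h := cls_eq_cls_segment P τ
    have h2 : P.comp τ = P.comp (segmentSimplex a b) := by
      ext t
      exact hp.map_smul γ
    rw [h2] at h
    simpa [τ] using h.symm
  -- `Φ` sends `γ` to the loop that the segment from `0` to `γ • 0` projects to.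
  let Φ : D →+ Opcycles X := MonoidHom.toAdditiveLeft (Abelianization.lift
    { toFun := fun γ : Γ => Multiplicative.ofAdd (L 0 (γ • 0))
      map_one' := by
        rw [one_smul]
        have := hL 0 0 0
        rw [left_eq_add] at this
        rw [this]; rfl
      map_mul' := fun γ γ' => by
        rw [← ofAdd_add, hL 0 (γ • 0), mul_smul, hLγ] })
  have hΦ : ∀ γ : Γ, Φ (q γ) = L 0 (γ • 0) := fun γ => rfl
  -- The defect `L 0 e - Φ (f e)` is constant on orbits, so it defines a map `k` on 0-chains of `X`.
  have hk : ∀ e e', p e = p e' → L 0 e - Φ (f e) = L 0 e' - Φ (f e') := by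
    intro e e' h
    obtain ⟨γ, rfl⟩ := hp.apply_eq_iff_mem_orbit.1 h
    dsimp only
    rw [hf, map_add, hΦ, hL 0 (γ • 0), hLγ]
    abel
  obtain ⟨k, hk'⟩ := exists_desc (n := 0) (X := X) (D := Opcycles X)
    fun σ => L 0 (s (σ (stdSimplex.vertex 0))) - Φ (f (s (σ (stdSimplex.vertex 0))))
  have hkp : ∀ e, k (point (p e)) = L 0 e - Φ (f e) := fun e =>
    (hk' _).trans (hk _ _ (hs _))
  -- A chain homotopy identity: `Φ ∘ Ψ` differs from the identity by `k ∘ ∂`, which vanishes on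
  -- cycles.
  have hid : (Φ.comp Ψ) + k.comp (bdry X) = AddMonoidHom.id _ := by
    refine opcycles_hom_ext fun σ => ?_
    obtain ⟨τ, hτ⟩ := hlift σ
    obtain rfl : P.comp τ = σ := by ext t; exact hτ t
    have h1 : cls (P.comp τ) = L (τ (stdSimplex.vertex 0)) (τ (stdSimplex.vertex 1)) :=
      cls_eq_cls_segment P τ
    have h2 := hL 0 (τ (stdSimplex.vertex 0)) (τ (stdSimplex.vertex 1))
    have h3 : ∀ t, (P.comp τ) t = p (τ t) := fun t => rfl
    rw [AddMonoidHom.add_apply, AddMonoidHom.comp_apply, AddMonoidHom.comp_apply, hΨ, hF, bdry_cls,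
      h3, h3, map_sub, map_sub, hkp, hkp, AddMonoidHom.id_apply, h1, h2]
    abel
  have hqsurj : ∀ d : D, ∃ γ, q γ = d := fun d =>
    let ⟨γ, hγ⟩ := QuotientGroup.mk_surjective d.toMul
    ⟨γ, congr_arg Additive.ofMul hγ⟩
  have hΨΦ : ∀ d, Ψ (Φ d) = d := by
    intro d
    obtain ⟨γ, rfl⟩ := hqsurj d
    rw [hΦ, hΨ, hF, segmentSimplex_vertex_one, segmentSimplex_vertex_zero, hf]
    abel
  have hΦb : ∀ d, bdry X (Φ d) = 0 := by
    intro d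
    obtain ⟨γ, rfl⟩ := hqsurj d
    rw [hΦ, bdry_cls]
    have : (P.comp (segmentSimplex 0 (γ • 0))) (stdSimplex.vertex 1) =
        (P.comp (segmentSimplex 0 (γ • 0))) (stdSimplex.vertex 0) := by
      simpa [P] using hp.map_smul γ (e := (0 : E))
    rw [this, sub_self]
  obtain ⟨e⟩ := nonempty_equiv_ker_bdry X
  refine ⟨e.trans
    { toFun := fun z => Ψ z.1
      invFun := fun d => ⟨Φ d, hΦb d⟩
      left_inv := fun z => Subtype.ext ?_
      right_inv := hΨΦ
      map_add' := fun x y => map_add Ψ x.1 y.1 }⟩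
  have h := DFunLike.congr_fun hid z.1
  rw [AddMonoidHom.add_apply, AddMonoidHom.comp_apply, AddMonoidHom.comp_apply,
    show bdry X z.1 = 0 from z.2, map_zero, add_zero] at h
  exact h

end SingularChain

end SingularHomology

/-! ### The torus as a quotient of `ℝ^m` by its lattice, and affine lifts -/

/-- The universal covering homomorphism of the torus. -/
def torusHom (m : ℕ) : (Fin m → ℝ) →+ UnitAddTorus (Fin m) where
  toFun := torusProj m
  map_zero' := by ext i; simp [torusProj]
  map_add' x y := by ext i; simp [torusProj]

/-- The lattice `ℤ^m` in `ℝ^m`. -/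
abbrev torusLattice (m : ℕ) : AddSubgroup (Fin m → ℝ) := (torusHom m).ker

theorem isOpenQuotientMap_torusProj (m : ℕ) : IsOpenQuotientMap (torusProj m) :=
  IsOpenQuotientMap.piMap fun _ => QuotientAddGroup.isOpenQuotientMap_mk

theorem isDiscrete_torusLattice (m : ℕ) : IsDiscrete (torusLattice m : Set (Fin m → ℝ)) := by
  rw [isDiscrete_iff_discreteTopology]
  refine discreteTopology_of_isOpen_singleton_zero ?_
  rw [isOpen_induced_iff]
  -- In the sup norm, a lattice vector in the unit ball has integer coordinates of absolute value
  -- less than `1`.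
  refine ⟨Metric.ball 0 1, Metric.isOpen_ball, ?_⟩
  ext ⟨v, hv⟩
  rw [Set.mem_preimage, Set.mem_singleton_iff, ← Subtype.coe_inj, ZeroMemClass.coe_zero]
  change v ∈ Metric.ball 0 1 ↔ v = 0
  refine ⟨fun h => ?_, fun h => by simp [h]⟩
  ext i
  have hi : ((v i : ℝ) : UnitAddCircle) = 0 := congr_fun hv i
  obtain ⟨n, hn⟩ := (AddCircle.coe_eq_zero_iff (1 : ℝ)).1 hi
  have h1 : |v i| < 1 := by
    have := (norm_le_pi_norm v i).trans_lt (mem_ball_zero_iff.1 h)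
    simpa using this
  rw [← hn] at h1 ⊢
  have : |n| < 1 := by
    have : |(n : ℝ)| < 1 := by simpa using h1
    exact_mod_cast this
  simp [Int.abs_lt_one_iff.1 this]

theorem isAddQuotientCoveringMap_torusProj (m : ℕ) :
    IsAddQuotientCoveringMap (torusProj m) (torusLattice m) :=
  Topology.IsQuotientMap.isAddQuotientCoveringMap_of_isDiscrete_ker_addMonoidHom (f := torusHom m)
    (isOpenQuotientMap_torusProj m).isQuotientMap (isDiscrete_torusLattice m)

theorem torusProj_eq_iff {m : ℕ} {x y : Fin m → ℝ} :
    torusProj m x = torusProj m y ↔ ∃ v : torusLattice m, (v : Fin m → ℝ) + y = x :=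
  (isAddQuotientCoveringMap_torusProj m).apply_eq_iff_mem_orbit

section Lift

variable {m : ℕ} {g : UnitAddTorus (Fin m) ≃ₜ UnitAddTorus (Fin m)}
  {φ : (Fin m → ℝ) ≃ᵃ[ℝ] (Fin m → ℝ)} (hφ : ∀ x, g (torusProj m x) = torusProj m (φ x))

theorem affineEquiv_add (φ : (Fin m → ℝ) ≃ᵃ[ℝ] (Fin m → ℝ)) (v x : Fin m → ℝ) :
    φ (v + x) = φ.linear v + φ x :=
  φ.map_vadd x v

-- `g` is well defined and injective, so `φ v` and `φ 0` have the same image in the torus exactly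
-- when `v` and `0` do.
include hφ in
theorem linear_mem_torusLattice_iff (v : Fin m → ℝ) :
    φ.linear v ∈ torusLattice m ↔ v ∈ torusLattice m := by
  have h : torusProj m (φ (v + 0)) = torusProj m (φ 0) ↔ torusProj m (v + 0) = torusProj m 0 := by
    rw [← hφ, ← hφ, g.injective.eq_iff]
  rw [affineEquiv_add] at h
  change torusHom m _ = torusHom m _ ↔ torusHom m _ = torusHom m _ at h
  simpa [AddMonoidHom.mem_ker] using h

/-- The automorphism of the lattice given by the linear part of an affine lift. -/
def latticeAut : torusLattice m ≃+ torusLattice m where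
  toFun v := ⟨φ.linear v, (linear_mem_torusLattice_iff hφ _).2 v.2⟩
  invFun v := ⟨φ.linear.symm v, (linear_mem_torusLattice_iff hφ _).1 (by simp)⟩
  left_inv v := by simp
  right_inv v := by simp
  map_add' v w := by ext; simp

theorem affineEquiv_lattice_add (v : torusLattice m) (x : Fin m → ℝ) :
    φ (v + x) = latticeAut hφ v + φ x :=
  affineEquiv_add φ v x

end Lift

/-! ### The fundamental group of the torus and the action of `g` on it -/

section FundamentalGroup

variable {m : ℕ} {g : UnitAddTorus (Fin m) ≃ₜ UnitAddTorus (Fin m)}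
  {φ : (Fin m → ℝ) ≃ᵃ[ℝ] (Fin m → ℝ)} (hφ : ∀ x, g (torusProj m x) = torusProj m (φ x))

theorem inducedPi1_apply {X : Type*} [TopologicalSpace X] (g : C(X, X)) {x₀ : X}
    (p : Path (g x₀) x₀) (c : FundamentalGroup X x₀) :
    inducedPi1 g p c = ((Path.Homotopic.Quotient.mk p).symm).trans
      ((Path.Homotopic.Quotient.map c g).trans (Path.Homotopic.Quotient.mk p)) := rfl

theorem torus_monodromy_add {x y : UnitAddTorus (Fin m)} (γ : Path.Homotopic.Quotient x y)
    (v : torusLattice m) (e e' : torusProj m ⁻¹' {x}) (he : e'.1 = v + e.1) :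
    (((isAddQuotientCoveringMap_torusProj m).isCoveringMap.monodromy γ e').1 : Fin m → ℝ) =
      v + ((isAddQuotientCoveringMap_torusProj m).isCoveringMap.monodromy γ e).1 := by
  have hp := isAddQuotientCoveringMap_torusProj m
  have h := hp.monodromy_toPermFiber (g := v) (γ := γ) (e := e)
  have he' : e' = hp.toMultiplicative.toPermFiber x v e := Subtype.ext he
  rw [he', h]
  rfl

-- If `Γ` lifts `γ`, then `φ ∘ Γ` lifts `g ∘ γ`.
include hφ in
theorem torus_monodromy_map {x y : UnitAddTorus (Fin m)} (γ : Path.Homotopic.Quotient x y)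
    (e : torusProj m ⁻¹' {x}) (e' : torusProj m ⁻¹' {g x}) (he : e'.1 = φ e.1) :
    ((isAddQuotientCoveringMap_torusProj m).isCoveringMap.monodromy
      (Path.Homotopic.Quotient.map γ (g : C(UnitAddTorus (Fin m), UnitAddTorus (Fin m)))) e').1 =
      φ ((isAddQuotientCoveringMap_torusProj m).isCoveringMap.monodromy γ e).1 := by
  have cov := (isAddQuotientCoveringMap_torusProj m).isCoveringMap
  obtain ⟨γ⟩ := γ
  have hφc : Continuous φ := φ.toAffineMap.continuous_of_finiteDimensional
  let Γ := cov.liftPath γ e.1 (γ.source.trans e.2.symm)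
  have hΓ : ∀ t, torusProj m (Γ t) = γ t := congr_fun (cov.liftPath_lifts γ e.1 _)
  let Γ' : C(unitInterval, Fin m → ℝ) := ⟨fun t => φ (Γ t), hφc.comp Γ.continuous⟩
  have h0 : Γ' 0 = e'.1 := by
    rw [he]
    exact congr_arg φ (cov.liftPath_zero γ e.1 _)
  have h := (cov.eq_liftPath_iff' (γ := (γ.map g.continuous : C(unitInterval, _))) (e := e'.1)
    (((γ.map g.continuous).source).trans e'.2.symm) (Γ := Γ')).2
    ⟨by ext1 t; exact (hφ _).symm.trans (congr_arg g (hΓ t)), h0⟩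
  exact (DFunLike.congr_fun h 1).symm

/-- The fundamental group of the torus is the lattice, acting by monodromy. -/
theorem exists_fundamentalGroup_torus_equiv_lattice (x₀ : UnitAddTorus (Fin m)) :
    ∃ d : Additive (FundamentalGroup (UnitAddTorus (Fin m)) x₀) ≃+ torusLattice m,
      ∀ (c : FundamentalGroup (UnitAddTorus (Fin m)) x₀) (e : torusProj m ⁻¹' {x₀}),
        ((isAddQuotientCoveringMap_torusProj m).isCoveringMap.monodromy c e).1 =
          (d (.ofMul c) : torusLattice m) + e.1 := by
  have hp := isAddQuotientCoveringMap_torusProj m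
  obtain ⟨e₀, he₀⟩ := hp.surjective x₀
  let d₀ := hp.toMultiplicative.fundamentalGroupEquiv (⟨e₀, he₀⟩ : torusProj m ⁻¹' {x₀})
  let f : Additive (FundamentalGroup (UnitAddTorus (Fin m)) x₀) → torusLattice m :=
    fun c => (d₀ c.toMul).unop.toAdd
  have hf : ∀ c c', f (c + c') = f c + f c' := fun c c' => by
    change (d₀ (c.toMul * c'.toMul)).unop.toAdd = _
    rw [map_mul]
    -- The loop group is matched with the opposite of the deck group; the order is immaterial
    -- because the lattice is commutative.
    exact add_comm _ _
  have hbij : Function.Bijective f := by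
    refine ⟨fun c c' h => d₀.injective (MulOpposite.unop_injective h), fun v => ?_⟩
    obtain ⟨c, hc⟩ := d₀.surjective (.op (.ofAdd v))
    exact ⟨.ofMul c, congr_arg MulOpposite.unop hc⟩
  have hd : ∀ c, (hp.isCoveringMap.monodromy c ⟨e₀, he₀⟩).1 = (f (.ofMul c)).1 + e₀ := fun c =>
    (hp.toMultiplicative.unop_fundamentalGroupToMulOpposite_smul
      (e := (⟨e₀, he₀⟩ : torusProj m ⁻¹' {x₀}))).symm
  refine ⟨AddEquiv.ofBijective (AddMonoidHom.mk' f hf) hbij, fun c e => ?_⟩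
  change _ = (f (.ofMul c)).1 + e.1
  obtain ⟨v, hv⟩ := torusProj_eq_iff.1 (e.2.trans he₀.symm)
  rw [torus_monodromy_add c v ⟨e₀, he₀⟩ e hv.symm, hd, ← hv, add_left_comm]

include hφ in
/-- A self-map of the torus covered by an affine map acts on the fundamental group by the linear
part of the affine map. -/
theorem exists_fundamentalGroup_torus_equiv (x₀ : UnitAddTorus (Fin m)) (p : Path (g x₀) x₀) :
    ∃ d : Additive (FundamentalGroup (UnitAddTorus (Fin m)) x₀) ≃+ torusLattice m,
      ∀ c : FundamentalGroup (UnitAddTorus (Fin m)) x₀,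
        d (.ofMul (inducedPi1 (g : C(UnitAddTorus (Fin m), UnitAddTorus (Fin m))) p c)) =
          latticeAut hφ (d (.ofMul c)) := by
  have cov := (isAddQuotientCoveringMap_torusProj m).isCoveringMap
  obtain ⟨d, hd⟩ := exists_fundamentalGroup_torus_equiv_lattice x₀
  refine ⟨d, fun c => ?_⟩
  obtain ⟨e, he⟩ := (isAddQuotientCoveringMap_torusProj m).surjective x₀
  let e₀ : torusProj m ⁻¹' {x₀} := ⟨e, he⟩
  let e₁ : torusProj m ⁻¹' {g x₀} := ⟨φ e, by rw [Set.mem_preimage, ← hφ, he]; rfl⟩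
  -- Starting the lift at `e₂`, the transport back along `p` ends at `φ e`; then `g ∘ c` adds `L (d
  -- c)`, and transport along `p` carries this translation to `e₂`. The choice of `p` thus cancels.
  let e₂ := cov.monodromy (.mk p) e₁
  have h1 := hd (inducedPi1 (g : C(UnitAddTorus (Fin m), UnitAddTorus (Fin m))) p c) e₂
  have h2 : cov.monodromy (Path.Homotopic.Quotient.symm (.mk p)) e₂ = e₁ := by
    rw [← cov.monodromy_trans_apply]
    have : (Path.Homotopic.Quotient.mk p).trans (Path.Homotopic.Quotient.symm (.mk p)) =
        .refl _ :=
      Path.Homotopic.Quotient.eq.2 ⟨(Path.Homotopy.reflTransSymm p).symm⟩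
    rw [this, cov.monodromy_refl]
    rfl
  rw [inducedPi1_apply, cov.monodromy_trans_apply, h2, cov.monodromy_trans_apply] at h1
  have h3 := torus_monodromy_map hφ c e₀ e₁ rfl
  rw [hd, affineEquiv_lattice_add hφ] at h3
  rw [torus_monodromy_add (.mk p) (latticeAut hφ (d (.ofMul c))) e₁ _ h3] at h1
  exact Subtype.ext (add_right_cancel h1).symm

end FundamentalGroup

/-! ### The deck group of the mapping torus -/

/-- The extension of `ℤ` by an abelian group `V`, where the generator acts by `L`. -/
abbrev IntExtension {V : Type} [AddCommGroup V] (L : V ≃+ V) : Type :=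
  Multiplicative V ⋊[zpowersHom (MulAut (Multiplicative V)) (AddEquiv.toMultiplicative L)]
    Multiplicative ℤ

namespace MappingTorus

variable {m : ℕ} {g : UnitAddTorus (Fin m) ≃ₜ UnitAddTorus (Fin m)}
  {φ : (Fin m → ℝ) ≃ᵃ[ℝ] (Fin m → ℝ)} (hφ : ∀ x, g (torusProj m x) = torusProj m (φ x))

theorem affineEquiv_mul_apply (φ ψ : (Fin m → ℝ) ≃ᵃ[ℝ] (Fin m → ℝ)) (x : Fin m → ℝ) :
    (φ * ψ) x = φ (ψ x) := rfl

theorem zpow_affineEquiv_lattice_add (j : ℤ) (v : torusLattice m) (x : Fin m → ℝ) :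
    (φ ^ j) (v + x) =
      ((AddEquiv.toMultiplicative (latticeAut hφ) ^ j : MulAut (Multiplicative (torusLattice m)))
        (.ofAdd v)).toAdd + (φ ^ j) x := by
  induction j generalizing v x with
  | zero => simp
  | succ j ih =>
    rw [zpow_add_one, zpow_add_one, affineEquiv_mul_apply, MulAut.mul_apply,
      affineEquiv_lattice_add hφ, ih]
    rfl
  | pred j ih =>
    have h : φ⁻¹ (v + x) = (latticeAut hφ).symm v + φ⁻¹ x := by
      apply φ.injective
      rw [affineEquiv_lattice_add hφ, AddEquiv.apply_symm_apply]
      simp [AffineEquiv.inv_def]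
    rw [zpow_sub_one, zpow_sub_one, affineEquiv_mul_apply, MulAut.mul_apply, h, ih]
    rfl

include hφ in
theorem zpow_torusProj (j : ℤ) (x : Fin m → ℝ) :
    (g ^ j) (torusProj m x) = torusProj m ((φ ^ j) x) := by
  induction j generalizing x with
  | zero => simp
  | succ j ih =>
    rw [zpow_add_one, zpow_add_one, affineEquiv_mul_apply, Homeomorph.mul_apply, hφ, ih]
  | pred j ih =>
    have h : g⁻¹ (torusProj m x) = torusProj m (φ⁻¹ x) := by
      apply g.injective
      rw [hφ, ← Homeomorph.mul_apply, mul_inv_cancel]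
      simp [AffineEquiv.inv_def]
    rw [zpow_sub_one, zpow_sub_one, affineEquiv_mul_apply, Homeomorph.mul_apply, h, ih]

/-- The action of the deck group of the universal covering of the mapping torus. -/
@[reducible] def deckAction :
    MulAction (IntExtension (latticeAut hφ)) ((Fin m → ℝ) × ℝ) where
  smul γ a := (γ.left.toAdd + (φ ^ γ.right.toAdd) a.1, a.2 - γ.right.toAdd)
  one_smul a := by
    change ((_ : Fin m → ℝ), (_ : ℝ)) = _
    ext <;> simp
  mul_smul γ γ' a := by
    change (((γ * γ').left.toAdd : Fin m → ℝ) + (φ ^ (γ * γ').right.toAdd) a.1,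
      a.2 - ((γ * γ').right.toAdd : ℝ)) =
      ((γ.left.toAdd : Fin m → ℝ) + (φ ^ γ.right.toAdd)
        ((γ'.left.toAdd : Fin m → ℝ) + (φ ^ γ'.right.toAdd) a.1),
        a.2 - (γ'.right.toAdd : ℝ) - (γ.right.toAdd : ℝ))
    ext1
    · dsimp only
      rw [zpow_affineEquiv_lattice_add hφ, ← add_assoc, SemidirectProduct.mul_right, toAdd_mul,
        zpow_add]
      rfl
    · dsimp only
      rw [SemidirectProduct.mul_right, toAdd_mul]
      push_cast
      ring

/-- The universal covering map of the mapping torus of a torus homeomorphism. -/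
def univCover (g : UnitAddTorus (Fin m) ≃ₜ UnitAddTorus (Fin m)) (a : (Fin m → ℝ) × ℝ) :
    MappingTorus g :=
  Quotient.mk (mappingTorusSetoid g) (torusProj m a.1, a.2)

theorem isQuotientMap_univCover (g : UnitAddTorus (Fin m) ≃ₜ UnitAddTorus (Fin m)) :
    Topology.IsQuotientMap (univCover g) :=
  isQuotientMap_quotient_mk'.comp
    ((isOpenQuotientMap_torusProj m).prodMap IsOpenQuotientMap.id).isQuotientMap

theorem isQuotientCoveringMap_univCover :
    letI := deckAction hφ
    IsQuotientCoveringMap (univCover g) (IntExtension (latticeAut hφ)) := by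
  let := deckAction hφ
  have hsmul : ∀ (γ : IntExtension (latticeAut hφ)) (a : (Fin m → ℝ) × ℝ),
      γ • a = (γ.left.toAdd + (φ ^ γ.right.toAdd) a.1, a.2 - γ.right.toAdd) := fun _ _ => rfl
  refine
    { toIsQuotientMap := isQuotientMap_univCover g
      continuous_const_smul := fun γ => ?_
      apply_eq_iff_mem_orbit := fun {a b} => ?_
      disjoint := fun a => ?_ }
  · have h : Continuous (φ ^ γ.right.toAdd) :=
      (φ ^ γ.right.toAdd).toAffineMap.continuous_of_finiteDimensional
    simp only [hsmul]
    fun_prop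
  · refine Quotient.eq''.trans ⟨?_, ?_⟩
    · rintro ⟨j, h1, h2⟩
      dsimp only at h1 h2
      rw [zpow_torusProj hφ] at h1
      obtain ⟨v, hv⟩ := torusProj_eq_iff.1 h1
      refine MulAction.orbitRel_apply.1 (Setoid.symm' _ (MulAction.orbitRel_apply.2
        ⟨⟨.ofAdd v, .ofAdd j⟩, ?_⟩))
      dsimp only
      rw [hsmul]
      exact Prod.ext hv h2.symm
    · rintro ⟨γ, rfl⟩
      refine (mappingTorusSetoid g).symm' ⟨γ.right.toAdd, ?_, rfl⟩
      dsimp only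
      rw [zpow_torusProj hφ, hsmul]
      exact torusProj_eq_iff.2 ⟨γ.left.toAdd, rfl⟩
  · obtain ⟨U, hU, hdisj⟩ := (isAddQuotientCoveringMap_torusProj m).disjoint a.1
    -- Points of a ball of radius `1/2` are less than `1` apart, so the integer shift is zero; then
    -- `U` forces the lattice part to vanish.
    refine ⟨U ×ˢ Metric.ball a.2 (1 / 2),
      prod_mem_nhds hU (Metric.ball_mem_nhds _ (by norm_num)), fun γ => ?_⟩
    rintro ⟨_, ⟨b, hb, rfl⟩, hγb⟩
    dsimp only at hγb
    rw [hsmul] at hγb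
    have hr : γ.right.toAdd = 0 := by
      have h1 := hb.2
      have h2 := hγb.2
      rw [Metric.mem_ball, Real.dist_eq, abs_lt] at h1 h2
      dsimp only at h2
      rw [← Int.abs_lt_one_iff, abs_lt]
      constructor
      · have : (-1 : ℝ) < γ.right.toAdd := by linarith
        exact_mod_cast this
      · have : (γ.right.toAdd : ℝ) < 1 := by linarith
        exact_mod_cast this
    have hl : γ.left.toAdd = 0 := by
      refine hdisj _ ⟨_, ⟨b.1, hb.1, rfl⟩, ?_⟩
      have := hγb.1
      rwa [hr, zpow_zero] at this
    exact SemidirectProduct.ext hl hr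

end MappingTorus

/-! ### Abelianization of the extension -/

section IntExtension

variable {V : Type} [AddCommGroup V] (L : V ≃+ V)

/-- The image of `L - 1`. -/
abbrev subOneRange : AddSubgroup V := (L.toAddMonoidHom - AddMonoidHom.id V).range

theorem mk_zpow_apply (j : ℤ) (v : V) :
    (((AddEquiv.toMultiplicative L ^ j : MulAut (Multiplicative V)) (.ofAdd v)).toAdd :
      V ⧸ subOneRange L) = v := by
  have h : ∀ w, ((L w : V) : V ⧸ subOneRange L) = w := fun w => by
    rw [eq_comm, QuotientAddGroup.eq]
    exact ⟨w, by simp [sub_eq_neg_add]⟩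
  induction j generalizing v with
  | zero => simp
  | succ j ih =>
    rw [zpow_add_one, MulAut.mul_apply]
    exact (ih (L v)).trans (h v)
  | pred j ih =>
    rw [zpow_sub_one, MulAut.mul_apply]
    refine (ih (L.symm v)).trans ?_
    rw [← h, L.apply_symm_apply]

/-- The abelianization of an extension of `ℤ` by `V` is the coinvariants of `V` times `ℤ`. -/
theorem nonempty_abelianization_intExtension_equiv :
    Nonempty (Additive (Abelianization (IntExtension L)) ≃+ (V ⧸ subOneRange L) × ℤ) := by
  let F : IntExtension L →* Multiplicative ((V ⧸ subOneRange L) × ℤ) :=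
    { toFun := fun γ => .ofAdd ((γ.left.toAdd : V ⧸ subOneRange L), γ.right.toAdd)
      map_one' := rfl
      map_mul' := fun γ γ' => by
        rw [← ofAdd_add, Prod.mk_add_mk, SemidirectProduct.mul_left, SemidirectProduct.mul_right,
          toAdd_mul, toAdd_mul, QuotientAddGroup.mk_add]
        exact congr_arg (fun z => Multiplicative.ofAdd (_ + z, _)) (mk_zpow_apply L _ _) }
  let Ψ : Additive (Abelianization (IntExtension L)) →+ (V ⧸ subOneRange L) × ℤ :=
    MonoidHom.toAdditiveLeft (Abelianization.lift F)
  let q : IntExtension L → Additive (Abelianization (IntExtension L)) :=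
    fun γ => .ofMul (Abelianization.of γ)
  have hq : ∀ γ γ', q (γ * γ') = q γ + q γ' := fun γ γ' => by simp [q]
  let i : V →+ Additive (Abelianization (IntExtension L)) :=
    AddMonoidHom.mk' (fun v => q (SemidirectProduct.inl (.ofAdd v))) fun v w => by
      rw [← hq, ← map_mul]; rfl
  have hi : ∀ v, i (L v) = i v := fun v => by
    -- Conjugation by the generator of `ℤ` is `L`, so `L v` and `v` agree in the abelianization.
    have h : (SemidirectProduct.inl (.ofAdd (L v)) : IntExtension L) *
        SemidirectProduct.inr (.ofAdd 1) =
        SemidirectProduct.inr (.ofAdd 1) * SemidirectProduct.inl (.ofAdd v) := by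
      ext <;> simp
    have h2 := congr_arg q h
    rw [hq, hq, add_comm] at h2
    exact add_left_cancel h2
  let I : (V ⧸ subOneRange L) →+ Additive (Abelianization (IntExtension L)) :=
    QuotientAddGroup.lift _ i (by
      rintro _ ⟨v, rfl⟩
      simp [hi])
  let J : ℤ →+ Additive (Abelianization (IntExtension L)) :=
    AddMonoidHom.mk' (fun j => q (SemidirectProduct.inr (.ofAdd j))) fun v w => by
      rw [← hq, ← map_mul]; rfl
  have hΨ : ∀ γ, Ψ (q γ) = ((γ.left.toAdd : V ⧸ subOneRange L), γ.right.toAdd) := fun γ => rfl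
  refine ⟨{ Ψ with invFun := I.coprod J, left_inv := fun x => ?_, right_inv := fun y => ?_ }⟩
  · obtain ⟨γ, rfl⟩ : ∃ γ, q γ = x :=
      let ⟨γ, hγ⟩ := QuotientGroup.mk_surjective x.toMul
      ⟨γ, congr_arg Additive.ofMul hγ⟩
    change (I.coprod J) (Ψ (q γ)) = _
    rw [hΨ, AddMonoidHom.coprod_apply]
    change q (SemidirectProduct.inl γ.left) + q (SemidirectProduct.inr γ.right) = q γ
    rw [← hq, SemidirectProduct.inl_left_mul_inr_right]
  · obtain ⟨y, j⟩ := y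
    obtain ⟨v, rfl⟩ := QuotientAddGroup.mk_surjective y
    change Ψ (I v + J j) = _
    rw [map_add]
    change Ψ (q (SemidirectProduct.inl (.ofAdd v))) + Ψ (q (SemidirectProduct.inr (.ofAdd j))) = _
    rw [hΨ, hΨ]
    simp

end IntExtension

/-! ### Torsion subgroups -/

section Torsion

/-- An additive isomorphism of `ℤ`-modules is linear. -/
def AddEquiv.toLinearEquivInt {M N : Type*} [AddCommGroup M] [AddCommGroup N] [Module ℤ M]
    [Module ℤ N] (e : M ≃+ N) : M ≃ₗ[ℤ] N :=
  { e with map_smul' := fun n x => by simpa using map_intCast_smul e ℤ ℤ n x }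

/-- An additive isomorphism restricts to the torsion submodules over `ℤ`. -/
theorem nonempty_torsion_equiv {M N : Type*} [AddCommGroup M] [AddCommGroup N] [Module ℤ M]
    [Module ℤ N] (e : M ≃+ N) :
    Nonempty (Submodule.torsion ℤ M ≃+ Submodule.torsion ℤ N) := by
  let e' := e.toLinearEquivInt
  have h : ∀ x ∈ Submodule.torsion ℤ M, e' x ∈ Submodule.torsion ℤ N := fun x ⟨a, ha⟩ =>
    ⟨a, (e'.map_smul _ x).symm.trans ((congr_arg e' ha).trans (map_zero e'))⟩
  have h' : ∀ y ∈ Submodule.torsion ℤ N, e'.symm y ∈ Submodule.torsion ℤ M := fun y ⟨a, ha⟩ =>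
    ⟨a, (e'.symm.map_smul _ y).symm.trans
      ((congr_arg e'.symm ha).trans (map_zero e'.symm))⟩
  exact ⟨{ toFun := fun x => ⟨e' x, h x x.2⟩
           invFun := fun y => ⟨e'.symm y, h' y y.2⟩
           left_inv := fun x => Subtype.ext (e'.symm_apply_apply x)
           right_inv := fun y => Subtype.ext (e'.apply_symm_apply y)
           map_add' := fun x y => Subtype.ext (map_add e' x.1 y.1) }⟩

theorem nonempty_torsion_prod_int_equiv (M : Type*) [AddCommGroup M] :
    Nonempty (Submodule.torsion ℤ (M × ℤ) ≃+ Submodule.torsion ℤ M) := by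
  have h2 : ∀ x ∈ Submodule.torsion ℤ (M × ℤ), x.2 = 0 := by
    rintro ⟨x, n⟩ ⟨a, ha⟩
    have := congr_arg Prod.snd ha
    exact (mul_eq_zero.1 this).resolve_left (nonZeroDivisors.ne_zero a.2)
  refine ⟨AddEquiv.ofBijective ((LinearMap.fst ℤ M ℤ).restrict (p := Submodule.torsion ℤ (M × ℤ))
    (q := Submodule.torsion ℤ M) ?_).toAddMonoidHom ⟨?_, ?_⟩⟩
  · rintro x ⟨a, ha⟩
    exact ⟨a, congr_arg Prod.fst ha⟩
  · rintro ⟨x, hx⟩ ⟨y, hy⟩ h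
    exact Subtype.ext (Prod.ext (congr_arg Subtype.val h) ((h2 x hx).trans (h2 y hy).symm))
  · rintro ⟨x, a, ha⟩
    exact ⟨⟨(x, 0), a, Prod.ext ha (smul_zero (a : ℤ))⟩, rfl⟩

end Torsion

/-- The torsion in the first homology of the mapping torus of an affine torus map. -/
theorem nonempty_torsion_singularH1_mappingTorus_equiv {m : ℕ}
    {g : UnitAddTorus (Fin m) ≃ₜ UnitAddTorus (Fin m)}
    {φ : (Fin m → ℝ) ≃ᵃ[ℝ] (Fin m → ℝ)} (hφ : ∀ x, g (torusProj m x) = torusProj m (φ x)) :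
    Nonempty (Submodule.torsion ℤ (singularH1 (MappingTorus g)) ≃+
      Submodule.torsion ℤ (torusLattice m ⧸ subOneRange (latticeAut hφ))) := by
  let := MappingTorus.deckAction hφ
  obtain ⟨e₁⟩ := SingularChain.nonempty_singularH1_equiv_abelianization
    (MappingTorus.isQuotientCoveringMap_univCover hφ)
  obtain ⟨e₂⟩ := nonempty_abelianization_intExtension_equiv (latticeAut hφ)
  obtain ⟨e₃⟩ := nonempty_torsion_equiv (e₁.trans e₂)
  obtain ⟨e₄⟩ := nonempty_torsion_prod_int_equiv (torusLattice m ⧸ subOneRange (latticeAut hφ))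
  exact ⟨e₃.trans e₄⟩

/-! ### Cohomology of a finite cyclic group -/

section Cohomology

variable {G : Type} [Group G] {A : Type} [AddCommGroup A] (ρ : Representation ℤ G A)

/-- For `x = g₀ ^ j` the difference telescopes into terms `±(ρ g₀ b - b)`. -/
theorem sub_mem_range_of_mem_zpowers {g₀ x : G} (hx : x ∈ Subgroup.zpowers g₀) (a : A) :
    ρ x a - a ∈ LinearMap.range (ρ g₀ - LinearMap.id) := by
  have hg : ∀ b, ρ g₀ b - b ∈ LinearMap.range (ρ g₀ - LinearMap.id) := fun b => ⟨b, rfl⟩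
  have hmul : ∀ y, ρ (g₀ * y) a = ρ g₀ (ρ y a) := fun y => by rw [map_mul, Module.End.mul_apply]
  obtain ⟨j, rfl⟩ := hx
  dsimp only
  induction j with
  | zero => simp
  | succ j ih =>
    rw [add_comm, zpow_one_add, hmul, ← sub_add_sub_cancel _ (ρ (g₀ ^ (j : ℤ)) a)]
    exact add_mem (hg _) ih
  | pred j ih =>
    have h := hg (ρ (g₀ ^ (-(j : ℤ) - 1)) a)
    rw [← hmul, ← zpow_one_add, add_sub_cancel] at h
    simpa using sub_mem ih h

/-- The kernel of the norm is the preimage of the torsion in the coinvariants. -/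
theorem mem_ker_norm_iff [Fintype G] {g₀ : G} (hg₀ : ∀ x : G, x ∈ Subgroup.zpowers g₀)
    (hA : ∀ (n : ℤ) (a : A), n ≠ 0 → n • a = 0 → a = 0) (a : A) :
    ρ.norm a = 0 ↔ (Submodule.Quotient.mk a : A ⧸ LinearMap.range (ρ g₀ - LinearMap.id)) ∈
      Submodule.torsion ℤ (A ⧸ LinearMap.range (ρ g₀ - LinearMap.id)) := by
  have hnorm : ∀ b, ρ.norm b = ∑ x : G, ρ x b := fun b => by simp [Representation.norm]
  constructor
  · intro h
    refine ⟨⟨(Fintype.card G : ℤ), mem_nonZeroDivisors_of_ne_zero (by simp)⟩, ?_⟩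
    change (Fintype.card G : ℤ) •
      (Submodule.Quotient.mk a : A ⧸ LinearMap.range (ρ g₀ - LinearMap.id)) = 0
    rw [← Submodule.Quotient.mk_smul, Submodule.Quotient.mk_eq_zero, ← neg_mem_iff]
    -- When the norm of `a` vanishes, `|G|` itself kills the class of `a`.
    have : -((Fintype.card G : ℤ) • a) = ∑ x : G, (ρ x a - a) := by
      rw [Finset.sum_sub_distrib, ← hnorm, h]
      simp
    rw [this]
    exact sum_mem fun x _ => sub_mem_range_of_mem_zpowers ρ (hg₀ x) a
  · rintro ⟨n, hn⟩
    replace hn : (n : ℤ) •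
      (Submodule.Quotient.mk a : A ⧸ LinearMap.range (ρ g₀ - LinearMap.id)) = 0 := hn
    rw [← Submodule.Quotient.mk_smul, Submodule.Quotient.mk_eq_zero] at hn
    obtain ⟨b, hb⟩ := hn
    -- The norm kills `im(g₀ - 1)`, so `n • N a = 0`, and `A` has no torsion.
    refine hA n _ (nonZeroDivisors.ne_zero n.2) ?_
    rw [← map_smul, ← hb]
    have h2 : ρ.norm (ρ g₀ b) = ρ.norm b := by
      rw [hnorm, hnorm]
      refine Fintype.sum_equiv (Equiv.mulRight g₀) _ _ fun x => ?_
      simp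
    simp [h2]

/-- The first cohomology of a finite cyclic group with torsion-free coefficients is the torsion in
the coinvariants. -/
theorem nonempty_groupCohomology_H1_equiv_torsion [Finite G] {g₀ : G}
    (hg₀ : ∀ x : G, x ∈ Subgroup.zpowers g₀)
    (hA : ∀ (n : ℤ) (a : A), n ≠ 0 → n • a = 0 → a = 0) :
    Nonempty (groupCohomology.H1 (Rep.of ρ) ≃+
      Submodule.torsion ℤ (A ⧸ LinearMap.range (ρ g₀ - LinearMap.id))) := by
  have := Fintype.ofFinite G
  let cg : CommGroup G :=
    { (inferInstance : Group G) with
      mul_comm := fun x y => by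
        obtain ⟨i, rfl⟩ := hg₀ x
        obtain ⟨j, rfl⟩ := hg₀ y
        exact zpow_mul_comm g₀ i j }
  let R : Rep ℤ G := Rep.of ρ
  let T := Submodule.torsion ℤ (A ⧸ LinearMap.range (ρ g₀ - LinearMap.id))
  let π := Rep.FiniteCyclicGroup.groupCohomologyπOdd R g₀ hg₀ 1 odd_one
  have hπ : Function.Surjective π.hom := (ModuleCat.epi_iff_surjective _).1
    (CategoryTheory.epi_comp'
      (@CategoryTheory.IsIso.epi_of_iso _ _ _ _ _ (CategoryTheory.Iso.isIso_inv _))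
      (CategoryTheory.epi_comp' inferInstance inferInstance))
  let mkT : LinearMap.ker ρ.norm →ₗ[ℤ] T :=
    (LinearMap.range (ρ g₀ - LinearMap.id)).mkQ.restrict
      (p := LinearMap.ker ρ.norm) fun a ha => (mem_ker_norm_iff ρ hg₀ hA a).1 ha
  have hmkT : Function.Surjective mkT := by
    rintro ⟨x, hx⟩
    obtain ⟨a, rfl⟩ := Submodule.Quotient.mk_surjective _ x
    exact ⟨⟨a, (mem_ker_norm_iff ρ hg₀ hA a).2 hx⟩, rfl⟩
  -- `H¹` and the torsion of the coinvariants are both quotients of `ker N`, with the same kernel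
  -- `im(g₀ - 1)`.
  have hker : LinearMap.ker π.hom = LinearMap.ker mkT := by
    ext a
    refine (Rep.FiniteCyclicGroup.groupCohomologyπOdd_eq_zero_iff R g₀ hg₀ 1 odd_one a).trans ?_
    refine Iff.trans ?_ (Subtype.ext_iff (a1 := mkT a) (a2 := 0)).symm
    exact (Submodule.Quotient.mk_eq_zero _).symm
  let e₁ := π.hom.quotKerEquivOfSurjective hπ
  let e₂ := mkT.quotKerEquivOfSurjective hmkT
  exact ⟨(e₁.symm.toAddEquiv.trans (QuotientAddGroup.quotientAddEquivOfEq
    (congr_arg Submodule.toAddSubgroup hker))).trans e₂.toAddEquiv⟩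

end Cohomology

/-! ### Assembling the isomorphisms -/

theorem mainTheorem11 (m k : ℕ) (hk : 0 < k)
    {G : Type} [Group G] (hG : Nonempty (G ≃* Multiplicative (ZMod k)))
    (g₀ : G) (hg₀ : ∀ x : G, x ∈ Subgroup.zpowers g₀)
    {A : Type} [AddCommGroup A] (ρ : Representation ℤ G A)
    (g : UnitAddTorus (Fin m) ≃ₜ UnitAddTorus (Fin m)) (hg : IsAffineDiffeo g)
    (x₀ : UnitAddTorus (Fin m)) (p : Path (g x₀) x₀)
    (e : Additive (FundamentalGroup (UnitAddTorus (Fin m)) x₀) ≃+ A)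
    (hgg₀ : ∀ c : FundamentalGroup (UnitAddTorus (Fin m)) x₀,
      e (Additive.ofMul (inducedPi1 (g : C(UnitAddTorus (Fin m), UnitAddTorus (Fin m))) p c)) =
        ρ g₀ (e (Additive.ofMul c))) :
    Nonempty (Submodule.torsion ℤ (singularH1 (MappingTorus g)) ≃ₗ[ℤ]
        groupCohomology.H1 (Rep.of ρ)) ∧
      Nonempty (groupCohomology.H1 (Rep.of ρ) ≃ₗ[ℤ]
        Submodule.torsion ℤ (A ⧸ LinearMap.range (ρ g₀ - LinearMap.id))) := by
  obtain ⟨eG⟩ := hG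
  have : NeZero k := ⟨hk.ne'⟩
  have : Finite (Multiplicative (ZMod k)) := inferInstanceAs (Finite (ZMod k))
  have : Finite G := Finite.of_equiv _ eG.symm.toEquiv
  obtain ⟨φ, hφ⟩ := hg
  obtain ⟨d, hd⟩ := exists_fundamentalGroup_torus_equiv hφ x₀ p
  -- `u` intertwines `L` with `ρ g₀`. It transfers torsion-freeness from the lattice to `A` and
  -- identifies the two groups of coinvariants.
  let u : torusLattice m ≃+ A := d.symm.trans e
  have hu : ∀ v, u (latticeAut hφ v) = ρ g₀ (u v) := fun v => by
    obtain ⟨c, rfl⟩ := d.surjective v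
    have h := hgg₀ c.toMul
    have h2 := congr_arg d.symm (hd c.toMul)
    rw [d.symm_apply_apply] at h2
    rw [h2] at h
    simpa [u] using h
  have hA : ∀ (n : ℤ) (a : A), n ≠ 0 → n • a = 0 → a = 0 := by
    intro n a hn ha
    obtain ⟨v, rfl⟩ := u.surjective a
    rw [← map_zsmul, map_eq_zero_iff u u.injective] at ha
    have hv : n • (v : Fin m → ℝ) = 0 := congr_arg Subtype.val ha
    have hv0 : v = 0 := Subtype.ext ((smul_eq_zero.1 hv).resolve_left hn)
    rw [hv0, map_zero]
  obtain ⟨e₁⟩ := nonempty_groupCohomology_H1_equiv_torsion ρ hg₀ hA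
  obtain ⟨e₂⟩ := nonempty_torsion_singularH1_mappingTorus_equiv hφ
  let Q : (torusLattice m ⧸ subOneRange (latticeAut hφ)) ≃+
      (A ⧸ LinearMap.range (ρ g₀ - LinearMap.id)) :=
    QuotientAddGroup.congr _ (LinearMap.range (ρ g₀ - LinearMap.id)).toAddSubgroup u (by
      ext a
      constructor
      · rintro ⟨_, ⟨v, rfl⟩, rfl⟩
        exact ⟨u v, by simp [hu]⟩
      · rintro ⟨b, rfl⟩
        obtain ⟨v, rfl⟩ := u.surjective b
        exact ⟨_, ⟨v, rfl⟩, by simp [hu]⟩)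
  obtain ⟨e₃⟩ := nonempty_torsion_equiv Q
  exact ⟨⟨((e₂.trans e₃).trans e₁.symm).toLinearEquivInt⟩, ⟨e₁.toLinearEquivInt⟩⟩
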